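/- Let $N\ge 1$ and $L\ge 0$ be integers, let $U_1,\dots,U_L$ be unitaries on $N$ qubits with unitary channels $\mathcal U_\ell(\rho)=U_\ell\rho U_\ell^\dagger$, $\mathcal U_\ell^\dagger(\rho)=U_\ell^\dagger\rho U_\ell$, and let $\mathcal M,\mathcal N$ be completely positive trace-preserving (CPTP) maps on $N$-qubit operators. Define the noisy forward and backward circuits $$\mathcal E^{(L)}=\mathcal M\circ\mathcal U_L\circ\mathcal M\circ\cdots\circ\mathcal M\circ\mathcal U_1\circ\mathcal M,\qquad \mathcal F^{(L)}=\mathcal N\circ\mathcal U_1^\dagger\circ\mathcal N\circ\cdots\circ\mathcal N\circ\mathcal U_L^\dagger\circ\mathcal N .$$ Let $|v\rangle$ be an $N$-qubit pure state and $\rho_{\rm target}=|v\rangle\langle v|$. For an $N$-qubit state $\rho$ with single-qubit reduced density matrices $\rho_1,\dots,\rho_N$, let $\mathcal S(\rho)=\sum_{n=1}^N -\log_2{\rm Tr}[\rho_n^2]$, and put $S=\mathcal S(\mathcal F^{(L)}(\rho_{\rm target}))$. Let $$f_1(S)=\tfrac12\Big(1-\sqrt{2^{1-S/N}-1}\Big),\qquad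 f_2(S)=\tfrac12\Big(1-\sqrt{2^{1-S+\lfloor S\rfloor}-1}+\lfloor S\rfloor\Big),$$ let $\|X\|_1={\rm Tr}\sqrt{X^\dagger X}$, and let $\|\Phi\|_\diamond=\sup_{d\ge1}\sup_{X\ne0}\|(\Phi\otimes{\rm id}_d)(X)\|_1/\|X\|_1$ be the diamond norm. (i) For every product state $|\psi\rangle=\bigotimes_{n=1}^N|\psi_n\rangle$ (each $|\psi_n\rangle$ a single-qubit unit vector), $$1-{\rm Tr}\big[\rho_{\rm target}\,\mathcal E^{(L)}(|\psi\rangle\langle\psi|)\big]\ \ge\ f_1(S)-(L+1)\big(\|\mathcal M-{\rm id}\|_\diamond+\|\mathcal N-{\rm id}\|_\diamond\big).$$ (ii) A product state satisfying a matching upper bound can be constructed from $\mathcal F^{(L)}(\rho_{\rm target})$. Let $\hat\rho_n$ be the $n$-th single-qubit reduced density matrix of $\mathcal F^{(L)}(\rho_{\rm target})$, with entries indexed by $0,1$, and let $|\psi'\rangle=\bigotimes_{n=1}^N R_Z(\beta_n)R_Y(\gamma_n)|0\rangle$, where $R_Z(\theta)=e^{-i\theta Z/2}$, $R_Y(\theta)=e^{-i\theta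 Y/2}$ for the Pauli matrices $Y$, $Z$, $$\beta_n=\arg(\hat\rho_n)_{10},\qquad \gamma_n=\frac{\pi}{2}-\arcsin\frac{(\hat\rho_n)_{00}-(\hat\rho_n)_{11}}{\sqrt{4|(\hat\rho_n)_{10}|^2+((\hat\rho_n)_{00}-(\hat\rho_n)_{11})^2}},$$ with $\arg 0=0$ and the fraction read as $0$ when $\hat\rho_n=I/2$. Then $|\psi'\rangle$ is a product of unit vectors and $$1-{\rm Tr}\big[\rho_{\rm target}\,\mathcal E^{(L)}(|\psi'\rangle\langle\psi'|)\big]\ \le\ f_2(S)+(L+1)\big(\|\mathcal M-{\rm id}\|_\diamond+\|\mathcal N-{\rm id}\|_\diamond\big).$$ -/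

import Mathlib

open scoped MatrixOrder ComplexOrder

noncomputable section

namespace NoisyLoading

/-- Computational basis labels of an `N`-qubit register. -/
abbrev Register (N : ℕ) : Type := Fin N → Fin 2

/-- Linear maps on the operators of a system with basis labels `ι`. -/
abbrev SuperOp (ι : Type) : Type := Matrix ι ι ℂ →ₗ[ℂ] Matrix ι ι ℂ

variable {ι : Type} [Fintype ι] [DecidableEq ι]

/-! ### Norms and channels -/

/-- The trace norm `Tr √(X† X)`. -/
def traceNorm (X : Matrix ι ι ℂ) : ℝ :=
  (CFC.sqrt (X.conjTranspose * X)).trace.re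

/-- The map `Φ ⊗ id_d`: writing `X = ∑_{a,b} X_{ab} ⊗ |a⟩⟨b|` with blocks `X_{ab}`, it sends `X` to
`∑_{a,b} Φ(X_{ab}) ⊗ |a⟩⟨b|`. -/
def tensorId (Φ : SuperOp ι) (d : ℕ) : SuperOp (ι × Fin d) where
  toFun X := Matrix.of fun p q =>
    Φ (Matrix.of fun i j => X (i, p.2) (j, q.2)) p.1 q.1
  map_add' X Y := by
    ext p q
    exact congrFun (congrFun (Φ.map_add
      (Matrix.of fun i j => X (i, p.2) (j, q.2)) (Matrix.of fun i j => Y (i, p.2) (j, q.2)))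
      p.1) q.1
  map_smul' c X := by
    ext p q
    exact congrFun (congrFun (Φ.map_smul c
      (Matrix.of fun i j => X (i, p.2) (j, q.2))) p.1) q.1

/-- The diamond norm: the supremum of `‖(Φ ⊗ id_d)(X)‖₁ / ‖X‖₁` over all `d ≥ 1` and all operators
`X ≠ 0` on the system extended by a `d`-dimensional ancilla. -/
def diamondNorm (Φ : SuperOp ι) : ℝ :=
  sSup {r : ℝ | ∃ d : ℕ, 1 ≤ d ∧ ∃ X : Matrix (ι × Fin d) (ι × Fin d) ℂ, X ≠ 0 ∧
    r = traceNorm (tensorId Φ d X) / traceNorm X}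

/-- Completely positive and trace-preserving linear maps. -/
structure IsCPTP (Φ : SuperOp ι) : Prop where
  completelyPositive : ∀ (d : ℕ) (X : Matrix (ι × Fin d) (ι × Fin d) ℂ),
    X.PosSemidef → (tensorId Φ d X).PosSemidef
  tracePreserving : ∀ X : Matrix ι ι ℂ, (Φ X).trace = X.trace

/-- The unitary channel `ρ ↦ V ρ V†`. -/
def unitaryChannel (V : Matrix.unitaryGroup ι ℂ) : SuperOp ι where
  toFun ρ := (V : Matrix ι ι ℂ) * ρ * (V : Matrix ι ι ℂ).conjTranspose
  map_add' X Y := by rw [Matrix.mul_add, Matrix.add_mul]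
  map_smul' c X := by rw [Matrix.mul_smul, Matrix.smul_mul, RingHom.id_apply]

/-- The layered noisy circuit `K ∘ 𝒱_L ∘ K ∘ ⋯ ∘ K ∘ 𝒱_1 ∘ K` with `L` unitary layers
(`V 0` is applied first) and `L + 1` noise layers `K`. -/
def layeredCircuit (K : SuperOp ι) :
    (L : ℕ) → (Fin L → Matrix.unitaryGroup ι ℂ) → SuperOp ι
  | 0, _ => K
  | L + 1, V =>
      K ∘ₗ unitaryChannel (V (Fin.last L)) ∘ₗ layeredCircuit K L (fun l => V l.castSucc)

/-- The noisy forward circuit `M ∘ 𝒰_L ∘ M ∘ ⋯ ∘ M ∘ 𝒰_1 ∘ M`. -/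
def forwardCircuit (M : SuperOp ι) {L : ℕ} (U : Fin L → Matrix.unitaryGroup ι ℂ) : SuperOp ι :=
  layeredCircuit M L U

/-- The noisy backward circuit `K ∘ 𝒰_1† ∘ K ∘ ⋯ ∘ K ∘ 𝒰_L† ∘ K`. -/
def backwardCircuit (K : SuperOp ι) {L : ℕ} (U : Fin L → Matrix.unitaryGroup ι ℂ) : SuperOp ι :=
  layeredCircuit K L (fun l => star (U l.rev))

/-! ### States -/

/-- Unit vectors, that is, pure states. -/
def IsPureState (v : ι → ℂ) : Prop := ∑ i, ‖v i‖ ^ 2 = 1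

/-- The operator `|v⟩⟨v|`. -/
def ketbra (v : ι → ℂ) : Matrix ι ι ℂ := Matrix.vecMulVec v (star v)

/-- The tensor product `⊗ₙ |φ n⟩` of single-qubit vectors. -/
def productKet {N : ℕ} (φ : Fin N → Fin 2 → ℂ) : Register N → ℂ :=
  fun s => ∏ n, φ n (s n)

/-- The infidelity `1 - Tr[ρ σ]`. -/
def infidelity (ρ σ : Matrix ι ι ℂ) : ℝ := 1 - (ρ * σ).trace.re

/-- The reduced density matrix of qubit `n`, all other qubits being traced out: its `(a, b)` entry
sums `ρ s t` over all `s`, `t` with `s n = a`, `t n = b` that agree on the other qubits. -/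
def reducedQubit {N : ℕ} (ρ : Matrix (Register N) (Register N) ℂ) (n : Fin N) :
    Matrix (Fin 2) (Fin 2) ℂ :=
  Matrix.of fun a b =>
    ∑ s : Register N, if s n = a then ρ s (Function.update s n b) else 0

/-- The Rényi-2 entropy `-log₂ Tr[ρ²]`. -/
def renyiTwo (ρ : Matrix ι ι ℂ) : ℝ := -Real.logb 2 (ρ * ρ).trace.re

/-- The entanglement measure: the sum of the Rényi-2 entropies of all single-qubit reductions. -/
def entanglementMeasure {N : ℕ} (ρ : Matrix (Register N) (Register N) ℂ) : ℝ :=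
  ∑ n, renyiTwo (reducedQubit ρ n)

/-! ### The bounds and the constructed product state -/

/-- `f₁(S) = (1 - √(2^(1 - S/N) - 1)) / 2`. -/
def fLower (N : ℕ) (S : ℝ) : ℝ := (1 - √((2 : ℝ) ^ (1 - S / N) - 1)) / 2

/-- `f₂(S) = (1 - √(2^(1 - S + ⌊S⌋) - 1) + ⌊S⌋) / 2`. -/
def fUpper (S : ℝ) : ℝ := (1 - √((2 : ℝ) ^ (1 - S + ⌊S⌋) - 1) + ⌊S⌋) / 2

/-- The single-qubit vector `R_Z(β) R_Y(γ) |0⟩`. -/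
def rotatedKet (β γ : ℝ) : Fin 2 → ℂ :=
  ![Complex.exp (-(Complex.I * β / 2)) * Real.cos (γ / 2),
    Complex.exp (Complex.I * β / 2) * Real.sin (γ / 2)]

/-- The azimuthal angle `arg ρ₁₀` of a single-qubit density matrix. -/
def qubitBeta (ρ : Matrix (Fin 2) (Fin 2) ℂ) : ℝ := (ρ 1 0).arg

/-- The polar angle `π/2 - arcsin ((ρ₀₀ - ρ₁₁) / √(4|ρ₁₀|² + (ρ₀₀ - ρ₁₁)²))` of a single-qubit
density matrix; for the maximally mixed state the fraction counts as `0`. -/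
def qubitGamma (ρ : Matrix (Fin 2) (Fin 2) ℂ) : ℝ :=
  Real.pi / 2 - Real.arcsin (((ρ 0 0).re - (ρ 1 1).re) /
    √(4 * ‖ρ 1 0‖ ^ 2 + ((ρ 0 0).re - (ρ 1 1).re) ^ 2))

/-- The single-qubit factors of the product state constructed from an `N`-qubit density matrix `ρ`,
qubit by qubit, out of the single-qubit reductions of `ρ`. -/
def constructedFactors {N : ℕ} (ρ : Matrix (Register N) (Register N) ℂ) :
    Fin N → Fin 2 → ℂ :=
  fun n => rotatedKet (qubitBeta (reducedQubit ρ n)) (qubitGamma (reducedQubit ρ n))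

end NoisyLoading

end

open NoisyLoading

namespace NoisyLoading

open Matrix

set_option linter.unusedSectionVars false

/-! ### The trace norm and positive block matrices -/

section Ketbra

variable {ι : Type} [Fintype ι]

/-! Without noise the backward circuit is the adjoint of the forward one, so the fidelity of the
prepared state with the target equals the overlap of the product state with the back-propagated
target. Each noise layer acts on a genuine state, and deleting it changes an expectation in a pure
state by at most its diamond distance to the identity. Passing from the noisy forward circuit to the
noiseless one, taking the adjoint and putting the backward noise in costs `L + 1` such errors for
each kind of noise (`abs_trace_forwardCircuit_sub_le`).

What remains concerns a single density matrix `ρ`, the output of the noisy backward circuit, and its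
overlaps with product states. Measure `ρ` in a product basis containing the product state. The
probability that all qubits give the outcome 0 is at most that for any one qubit
(`overlap_productKet_le`), and its complement is at most the sum of the single-qubit failure
probabilities (`one_sub_overlap_productKet_le`). For one qubit of Rényi-2 entropy `s` the best
overlap is `(1 + r) / 2` with Bloch radius `r = √(2^(1 - s) - 1)`, attained by the constructed
rotation angles.

Some qubit has entropy at least the average `S / N`, which gives `fLower`. For the upper bound, `r`
is concave in `s` (`concaveOn_radiusOfEntropy`), so for a given total entropy the sum of the
single-qubit infidelities is largest when the entropies are pushed to 0 and 1 with one fractional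
remainder; this extreme value is `fUpper`.

The trace norm is handled throughout by positive 2 × 2 block matrices with the given operator off
the diagonal, a form that completely positive maps preserve. -/

theorem trace_ketbra_mul (w : ι → ℂ) (X : Matrix ι ι ℂ) :
    (ketbra w * X).trace = star w ⬝ᵥ (X *ᵥ w) := by
  rw [ketbra, vecMulVec_mul, trace_vecMulVec, dotProduct_comm, ← dotProduct_mulVec]

/-- The operator `|w⟩⟨w|` has trace one, for a unit vector `w`. -/
theorem trace_ketbra {w : ι → ℂ} (hw : IsPureState w) : (ketbra w).trace = 1 := by
  rw [ketbra, trace_vecMulVec]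
  have : (∑ i, ((‖w i‖ ^ 2 : ℝ) : ℂ)) = 1 := by
    rw [← Complex.ofReal_sum, show ∑ i, ‖w i‖ ^ 2 = 1 from hw, Complex.ofReal_one]
  rw [← this]
  refine Finset.sum_congr rfl fun i _ => ?_
  simp [Complex.mul_conj, Complex.normSq_eq_norm_sq]

theorem posSemidef_ketbra (w : ι → ℂ) : (ketbra w).PosSemidef := posSemidef_vecMulVec_self_star w

end Ketbra

section TraceNorm

variable {ι : Type} [Fintype ι] [DecidableEq ι]

/-- A positive semidefinite matrix has a positive semidefinite pseudo-inverse commuting with it. -/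
theorem exists_pseudoinverse {P : Matrix ι ι ℂ} (hP : P.PosSemidef) :
    ∃ Q : Matrix ι ι ℂ, Q.PosSemidef ∧ P * Q = Q * P ∧ P * Q * P = P ∧ Q * P * Q = Q := by
  have hsa : IsSelfAdjoint P := hP.isHermitian
  have hid : cfc (fun x : ℝ => x) P = P := cfc_id' ℝ P
  have hc (f : ℝ → ℝ) : ContinuousOn f (spectrum ℝ P) := P.finite_real_spectrum.continuousOn f
  have hmul (f g : ℝ → ℝ) : cfc f P * cfc g P = cfc (fun x => f x * g x) P :=
    (cfc_mul f g P (hc f) (hc g)).symm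
  -- The convention `0⁻¹ = 0` makes this the inverse on the support of `P` and zero on its kernel.
  refine ⟨cfc (fun x : ℝ => x⁻¹) P, ?_, ?_, ?_, ?_⟩
  · rw [← nonneg_iff_posSemidef]
    refine cfc_nonneg fun x hx => inv_nonneg.2 ?_
    exact spectrum_nonneg_of_nonneg (nonneg_iff_posSemidef.2 hP) hx
  · nth_rewrite 1 [← hid]
    nth_rewrite 4 [← hid]
    rw [hmul, hmul]
    simp only [mul_comm]
  · nth_rewrite 1 [← hid]
    nth_rewrite 3 [← hid]
    rw [hmul, hmul]
    nth_rewrite 2 [← hid]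
    congr 1
    ext x
    simp
  · nth_rewrite 2 [← hid]
    rw [hmul, hmul]
    congr 1
    ext x
    by_cases h : x = 0 <;> simp [h]

/-- The polar data of a matrix: its absolute value `P`, and a pseudo-inverse `Q` of `P`. -/
theorem exists_polar (X : Matrix ι ι ℂ) :
    ∃ P Q : Matrix ι ι ℂ, P.PosSemidef ∧ Q.PosSemidef ∧ P * Q = Q * P ∧ P * Q * P = P ∧
      Q * P * Q = Q ∧ Xᴴ * X = P * P ∧ X * Q * P = X ∧ traceNorm X = P.trace.re := by
  have hXX : (0 : Matrix ι ι ℂ) ≤ Xᴴ * X :=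
    nonneg_iff_posSemidef.2 (posSemidef_conjTranspose_mul_self X)
  set P := CFC.sqrt (Xᴴ * X) with hPdef
  have hP : P.PosSemidef := nonneg_iff_posSemidef.1 (CFC.sqrt_nonneg _)
  obtain ⟨Q, hQ, hc, h1, h2⟩ := exists_pseudoinverse hP
  have hsq : Xᴴ * X = P * P := (CFC.sqrt_mul_sqrt_self _ hXX).symm
  refine ⟨P, Q, hP, hQ, hc, h1, h2, hsq, ?_, rfl⟩
  -- `Q * P` projects onto the support of `P`, and `X` has the same kernel as `P`.
  have hz : (X * Q * P - X)ᴴ * (X * Q * P - X) = 0 := by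
    simp only [conjTranspose_sub, conjTranspose_mul, hP.isHermitian.eq, hQ.isHermitian.eq]
    have : (P * (Q * Xᴴ) - Xᴴ) * (X * Q * P - X)
        = P * Q * (Xᴴ * X) * Q * P - P * Q * (Xᴴ * X) - (Xᴴ * X) * Q * P + Xᴴ * X := by
      noncomm_ring
    rw [this, hsq]
    have e1 : P * Q * (P * P) = P * P := by rw [← mul_assoc, h1]
    have e2 : P * P * Q * P = P * P := by rw [mul_assoc P P Q, mul_assoc P (P * Q) P, h1]
    rw [e1, e2]
    simp
  exact sub_eq_zero.1 (conjTranspose_mul_self_eq_zero.1 hz)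

/-- Every matrix is an off-diagonal block of a positive matrix of trace twice its trace norm. -/
theorem exists_posSemidef_fromBlocks (X : Matrix ι ι ℂ) :
    ∃ A B : Matrix ι ι ℂ, (fromBlocks A X Xᴴ B).PosSemidef ∧
      A.trace.re = traceNorm X ∧ B.trace.re = traceNorm X := by
  obtain ⟨P, Q, hP, hQ, hc, h1, h2, hsq, hX, ht⟩ := exists_polar X
  -- These diagonal blocks make the block matrix equal to `R * Q * Rᴴ`, where `R` is the column with
  -- blocks `X` and `P`.
  refine ⟨X * Q * Xᴴ, P, ?_, ?_, ht.symm⟩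
  · have key := hQ.mul_mul_conjTranspose_same (fromRows X P)
    have hX' : P * Q * Xᴴ = Xᴴ := by
      have := congrArg conjTranspose hX
      simpa [conjTranspose_mul, hP.isHermitian.eq, hQ.isHermitian.eq, mul_assoc] using this
    have : fromRows X P * Q * (fromRows X P)ᴴ = fromBlocks (X * Q * Xᴴ) X Xᴴ P := by
      rw [conjTranspose_fromRows_eq_fromCols_conjTranspose, fromRows_mul, fromRows_mul_fromCols,
        hP.isHermitian.eq, hX, hX', h1]
    rwa [this] at key
  · rw [ht, trace_mul_cycle, hsq, mul_assoc, hc, ← mul_assoc, h1]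

/-- The trace norm of an off-diagonal block of a positive matrix is at most half its trace. -/
theorem traceNorm_le_of_posSemidef_fromBlocks {A X Y B : Matrix ι ι ℂ}
    (h : (fromBlocks A X Y B).PosSemidef) : traceNorm X ≤ (A.trace.re + B.trace.re) / 2 := by
  obtain ⟨P, Q, hP, hQ, hc, h1, h2, hsq, hX, ht⟩ := exists_polar X
  have hh := h.isHermitian
  rw [isHermitian_fromBlocks_iff] at hh
  obtain ⟨hA, hY, -, hB⟩ := hh
  subst hY
  have hApos : A.PosSemidef := h.submatrix Sum.inl
  -- With `W = X * Q`, the partial isometry of the polar decomposition, compressing by the column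
  -- `(W, -1)` gives `2 Tr P ≤ Tr (Wᴴ A W) + Tr B`.
  have key := (h.conjTranspose_mul_mul_same (fromRows (X * Q) (-1 : Matrix ι ι ℂ))).trace_nonneg
  have e : (fromRows (X * Q) (-1 : Matrix ι ι ℂ))ᴴ * fromBlocks A X Xᴴ B * fromRows (X * Q) (-1 : Matrix ι ι ℂ)
      = Q * Xᴴ * A * X * Q - P - P + B := by
    have e1 : Q * (Xᴴ * X) = P := by rw [hsq, ← mul_assoc, ← hc, h1]
    have e2 : Xᴴ * X * Q = P := by rw [hsq, mul_assoc, hc, ← mul_assoc, h1]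
    rw [conjTranspose_fromRows_eq_fromCols_conjTranspose,
      Matrix.mul_assoc _ (fromBlocks A X Xᴴ B), fromBlocks_mul_fromRows,
      fromCols_mul_fromRows, conjTranspose_mul, hQ.isHermitian.eq]
    simp only [conjTranspose_neg, conjTranspose_one]
    calc _ = Q * Xᴴ * A * X * Q - Q * (Xᴴ * X) - Xᴴ * X * Q + B := by noncomm_ring
      _ = _ := by rw [e1, e2]
  rw [e] at key
  have hE : (1 - X * Q * Q * Xᴴ) * A * (1 - X * Q * Q * Xᴴ)ᴴ
      = A - X * Q * Q * Xᴴ * A - A * (X * Q * Q * Xᴴ)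
        + X * Q * Q * Xᴴ * A * (X * Q * Q * Xᴴ) := by
    simp only [conjTranspose_sub, conjTranspose_mul, conjTranspose_one, hQ.isHermitian.eq,
      conjTranspose_conjTranspose]
    noncomm_ring
  -- `W Wᴴ` is a projection, so compressing `A` by its complement shows `Tr (Wᴴ A W) ≤ Tr A`.
  have hEE : (X * Q * Q * Xᴴ) * (X * Q * Q * Xᴴ) = X * Q * Q * Xᴴ := by
    have : Q * Q * (Xᴴ * X) * (Q * Q) = Q * Q := by
      rw [hsq]
      calc Q * Q * (P * P) * (Q * Q) = Q * (Q * P) * (P * Q) * Q := by noncomm_ring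
        _ = Q * (P * Q) * (Q * P) * Q := by rw [hc]
        _ = (Q * P * Q) * (Q * P * Q) := by noncomm_ring
        _ = Q * Q := by rw [h2]
    calc (X * Q * Q * Xᴴ) * (X * Q * Q * Xᴴ)
        = X * (Q * Q * (Xᴴ * X) * (Q * Q)) * Xᴴ := by noncomm_ring
      _ = _ := by rw [this]; noncomm_ring
  have key2 := (hApos.mul_mul_conjTranspose_same (1 - X * Q * Q * Xᴴ)).trace_nonneg
  rw [hE, trace_add, trace_sub, trace_sub, trace_mul_comm A,
    trace_mul_comm (X * Q * Q * Xᴴ * A), ← mul_assoc (X * Q * Q * Xᴴ) (X * Q * Q * Xᴴ) A,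
    hEE] at key2
  have e3 : (Q * Xᴴ * A * X * Q).trace = (X * Q * Q * Xᴴ * A).trace := by
    rw [show Q * Xᴴ * A * X * Q = (Q * Xᴴ * A) * (X * Q) by noncomm_ring, trace_mul_comm]
    congr 1
    noncomm_ring
  rw [trace_add, trace_sub, trace_sub, e3] at key
  have k1 := (Complex.le_def.1 key).1
  have k2 := (Complex.le_def.1 key2).1
  simp only [Complex.add_re, Complex.sub_re, Complex.zero_re] at k1 k2
  rw [ht]
  linarith

theorem traceNorm_eq_trace {X : Matrix ι ι ℂ} (hX : X.PosSemidef) : traceNorm X = X.trace.re := by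
  rw [traceNorm, hX.isHermitian.eq, CFC.sqrt_mul_self X (nonneg_iff_posSemidef.2 hX)]

/-- The expectation of a positive matrix in a unit vector is at most its trace. -/
theorem trace_ketbra_mul_le {w : ι → ℂ} (hw : IsPureState w) {A : Matrix ι ι ℂ}
    (hA : A.PosSemidef) : (ketbra w * A).trace.re ≤ A.trace.re := by
  have hkk : ketbra w * ketbra w = ketbra w := by
    have h1 : star w ⬝ᵥ w = 1 := by
      rw [dotProduct_comm, ← trace_vecMulVec]; exact trace_ketbra hw
    rw [ketbra, vecMulVec_mul_vecMulVec, h1]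
    simp
  have key := (hA.mul_mul_conjTranspose_same (1 - ketbra w)).trace_nonneg
  rw [conjTranspose_sub, conjTranspose_one, (posSemidef_ketbra w).isHermitian.eq, trace_mul_comm,
    ← mul_assoc, show (1 - ketbra w) * (1 - ketbra w) = 1 - ketbra w by
      rw [mul_sub, sub_mul, sub_mul, hkk]; simp, sub_mul, one_mul, trace_sub] at key
  have := (Complex.le_def.1 key).1
  simp only [Complex.sub_re, Complex.zero_re] at this
  linarith

/-- The expectation of a matrix in a unit vector is at most its trace norm. -/
theorem abs_trace_ketbra_mul_le {w : ι → ℂ} (hw : IsPureState w) (X : Matrix ι ι ℂ) :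
    |(ketbra w * X).trace.re| ≤ traceNorm X := by
  obtain ⟨A, B, h, hA, hB⟩ := exists_posSemidef_fromBlocks X
  have hApos : A.PosSemidef := h.submatrix Sum.inl
  have hBpos : B.PosSemidef := h.submatrix Sum.inr
  have a1 := trace_ketbra_mul_le hw hApos
  have b1 := trace_ketbra_mul_le hw hBpos
  have hconj : (star w ⬝ᵥ (Xᴴ *ᵥ w)).re = (star w ⬝ᵥ (X *ᵥ w)).re := by
    have : star w ⬝ᵥ (Xᴴ *ᵥ w) = star (star w ⬝ᵥ (X *ᵥ w)) := by
      rw [← star_dotProduct_star, star_star, star_mulVec, dotProduct_comm, ← dotProduct_mulVec,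
        dotProduct_comm]
    rw [this]; simp
  -- The test vectors `(w, w)` and `(w, -w)` bound the real expectation of `X` from both sides by
  -- the mean of those of `A` and `B`.
  have p1 := (Complex.le_def.1 (h.dotProduct_mulVec_nonneg (Sum.elim w w))).1
  have p2 := (Complex.le_def.1 (h.dotProduct_mulVec_nonneg (Sum.elim w (-w)))).1
  have es (x y : ι → ℂ) : star (Sum.elim x y) = Sum.elim (star x) (star y) := by
    ext i; cases i <;> rfl
  rw [es, fromBlocks_mulVec, Sum.elim_comp_inl, Sum.elim_comp_inr, sumElim_dotProduct_sumElim] at p1 p2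
  simp only [mulVec_neg, star_neg, neg_dotProduct, dotProduct_neg, dotProduct_add, Complex.add_re,
    Complex.neg_re, Complex.zero_re, hconj] at p1 p2
  simp only [trace_ketbra_mul] at a1 b1 ⊢
  rw [abs_le]
  constructor <;> linarith

end TraceNorm

/-! ### Channels and the diamond norm -/

section Channel

variable {ι : Type} [Fintype ι] [DecidableEq ι]

/-- Density matrices: positive matrices of trace one. -/
structure IsDensity (ρ : Matrix ι ι ℂ) : Prop where
  posSemidef : ρ.PosSemidef
  trace_eq_one : ρ.trace = 1

/-- A 2 × 2 block matrix over an ancilla of dimension `d` is an operator over one of dimension `d +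
d`, where complete positivity applies. -/
theorem IsCPTP.posSemidef_fromBlocks {Φ : SuperOp ι} (hΦ : IsCPTP Φ) {d : ℕ}
    {A X Y B : Matrix (ι × Fin d) (ι × Fin d) ℂ} (h : (fromBlocks A X Y B).PosSemidef) :
    (fromBlocks (tensorId Φ d A) (tensorId Φ d X) (tensorId Φ d Y)
      (tensorId Φ d B)).PosSemidef := by
  let g : ι × Fin (d + d) → (ι × Fin d) ⊕ (ι × Fin d) :=
    fun p => Sum.map (fun k => (p.1, k)) (fun k => (p.1, k)) (finSumFinEquiv.symm p.2)
  let g' : (ι × Fin d) ⊕ (ι × Fin d) → ι × Fin (d + d) :=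
    Sum.elim (fun p => (p.1, Fin.castAdd d p.2)) (fun p => (p.1, Fin.natAdd d p.2))
  have key := (hΦ.completelyPositive (d + d) _ (h.submatrix g)).submatrix g'
  convert key using 1
  ext (⟨i, k⟩ | ⟨i, k⟩) (⟨j, l⟩ | ⟨j, l⟩) <;>
    simp [tensorId, g, g', -Fin.natAdd_eq_addNat]

theorem IsCPTP.trace_tensorId {Φ : SuperOp ι} (hΦ : IsCPTP Φ) {d : ℕ}
    (X : Matrix (ι × Fin d) (ι × Fin d) ℂ) : (tensorId Φ d X).trace = X.trace := by
  have h (k : Fin d) := hΦ.tracePreserving (Matrix.of fun i j => X (i, k) (j, k))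
  simp only [trace, diag_apply, of_apply] at h
  simp only [trace, diag_apply, Fintype.sum_prod_type_right, tensorId, LinearMap.coe_mk,
    AddHom.coe_mk, of_apply]
  exact Finset.sum_congr rfl fun k _ => h k

theorem tensorId_sub_id (Φ : SuperOp ι) (d : ℕ) (X : Matrix (ι × Fin d) (ι × Fin d) ℂ) :
    tensorId (Φ - LinearMap.id) d X = tensorId Φ d X - X := by
  ext p q
  simp [tensorId]

theorem traceNorm_nonneg (X : Matrix ι ι ℂ) : 0 ≤ traceNorm X :=
  (Complex.le_def.1 (nonneg_iff_posSemidef.1 (CFC.sqrt_nonneg (Xᴴ * X))).trace_nonneg).1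

theorem IsCPTP.traceNorm_tensorId_sub_id_le {Φ : SuperOp ι} (hΦ : IsCPTP Φ) {d : ℕ}
    (X : Matrix (ι × Fin d) (ι × Fin d) ℂ) :
    traceNorm (tensorId (Φ - LinearMap.id) d X) ≤ 2 * traceNorm X := by
  obtain ⟨A, B, h, hA, hB⟩ := exists_posSemidef_fromBlocks X
  have h1 := hΦ.posSemidef_fromBlocks h
  -- Conjugation by `diag(1, -1)` flips the sign of the off-diagonal blocks. Adding the result to
  -- the image under `Φ` puts `Φ(X) - X` off the diagonal and doubles the trace.
  have h2 := h.mul_mul_conjTranspose_same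
    (fromBlocks 1 0 0 (-1) : Matrix ((ι × Fin d) ⊕ (ι × Fin d)) _ ℂ)
  rw [fromBlocks_conjTranspose, fromBlocks_multiply, fromBlocks_multiply] at h2
  have h3 := h1.add h2
  rw [fromBlocks_add] at h3
  have h4 := traceNorm_le_of_posSemidef_fromBlocks h3
  rw [tensorId_sub_id]
  simp only [conjTranspose_one, conjTranspose_zero, conjTranspose_neg, one_mul, zero_mul, mul_one,
    mul_zero, add_zero, zero_add, neg_mul, mul_neg, neg_neg, trace_add, Complex.add_re,
    hΦ.trace_tensorId, hA, hB] at h4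
  rw [← sub_eq_add_neg] at h4
  linarith

/-- A real `sSup` dominates the members of its set only if the set is bounded, so this is what lets
`diamondNorm` bound anything. -/
theorem IsCPTP.bddAbove_diamondNorm {Φ : SuperOp ι} (hΦ : IsCPTP Φ) :
    BddAbove {r : ℝ | ∃ d : ℕ, 1 ≤ d ∧ ∃ X : Matrix (ι × Fin d) (ι × Fin d) ℂ, X ≠ 0 ∧
      r = traceNorm (tensorId (Φ - LinearMap.id) d X) / traceNorm X} := by
  refine ⟨2, ?_⟩
  rintro r ⟨d, -, X, -, rfl⟩
  exact div_le_of_le_mul₀ (traceNorm_nonneg X) zero_le_two (hΦ.traceNorm_tensorId_sub_id_le X)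

/-- The expectation of a state changes under a channel by at most the diamond distance of the
channel to the identity. -/
theorem IsCPTP.abs_trace_ketbra_mul_sub_le {Φ : SuperOp ι} (hΦ : IsCPTP Φ) {w : ι → ℂ}
    (hw : IsPureState w) {ρ : Matrix ι ι ℂ} (hρ : IsDensity ρ) :
    |(ketbra w * Φ ρ).trace.re - (ketbra w * ρ).trace.re| ≤ diamondNorm (Φ - LinearMap.id) := by
  -- A trivial one-dimensional ancilla already suffices for expectations of states.
  set X : Matrix (ι × Fin 1) (ι × Fin 1) ℂ := ρ.submatrix Prod.fst Prod.fst with hX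
  have hXtr : X.trace = 1 := by
    rw [← hρ.trace_eq_one]
    simp [trace, hX, Fintype.sum_prod_type]
  have hXn : traceNorm X = 1 := by
    rw [traceNorm_eq_trace (hρ.posSemidef.submatrix _), hXtr, Complex.one_re]
  have hX0 : X ≠ 0 := by
    intro h
    rw [h, trace_zero] at hXtr
    exact zero_ne_one hXtr
  have h1 : traceNorm (tensorId (Φ - LinearMap.id) 1 X) ≤ diamondNorm (Φ - LinearMap.id) :=
    le_csSup hΦ.bddAbove_diamondNorm ⟨1, le_rfl, X, hX0, by rw [hXn, div_one]⟩
  have hw' : IsPureState (fun p : ι × Fin 1 => w p.1) := by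
    simpa [IsPureState, Fintype.sum_prod_type] using hw
  refine le_trans (le_of_eq ?_) ((abs_trace_ketbra_mul_le hw' _).trans h1)
  rw [← Complex.sub_re, ← trace_sub, ← mul_sub]
  congr 2
  simp [trace, mul_apply, Fintype.sum_prod_type, ketbra, vecMulVec_apply, tensorId, hX]
  rfl

theorem IsCPTP.isDensity {Φ : SuperOp ι} (hΦ : IsCPTP Φ) {ρ : Matrix ι ι ℂ}
    (hρ : IsDensity ρ) : IsDensity (Φ ρ) := by
  refine ⟨?_, (hΦ.tracePreserving ρ).trans hρ.trace_eq_one⟩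
  have h := hΦ.completelyPositive 1 (ρ.submatrix Prod.fst Prod.fst) (hρ.posSemidef.submatrix _)
  exact h.submatrix fun i => (i, 0)

theorem unitaryChannel_apply (V : unitaryGroup ι ℂ) (X : Matrix ι ι ℂ) :
    unitaryChannel V X = (V : Matrix ι ι ℂ) * X * (V : Matrix ι ι ℂ)ᴴ := rfl

theorem isDensity_unitaryChannel (V : unitaryGroup ι ℂ) {ρ : Matrix ι ι ℂ}
    (hρ : IsDensity ρ) : IsDensity (unitaryChannel V ρ) := by
  refine ⟨hρ.posSemidef.mul_mul_conjTranspose_same _, ?_⟩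
  have : (V : Matrix ι ι ℂ)ᴴ * V = 1 := UnitaryGroup.star_mul_self V
  rw [unitaryChannel_apply, trace_mul_cycle, this, one_mul, hρ.trace_eq_one]

theorem isDensity_ketbra {w : ι → ℂ} (hw : IsPureState w) : IsDensity (ketbra w) :=
  ⟨posSemidef_ketbra w, trace_ketbra hw⟩

theorem IsCPTP.isDensity_layeredCircuit {Φ : SuperOp ι} (hΦ : IsCPTP Φ) {ρ : Matrix ι ι ℂ}
    (hρ : IsDensity ρ) (L : ℕ) (V : Fin L → unitaryGroup ι ℂ) :
    IsDensity (layeredCircuit Φ L V ρ) := by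
  induction L with
  | zero => exact hΦ.isDensity hρ
  | succ L ih =>
    have h := isDensity_unitaryChannel (V (Fin.last L)) (ih fun l => V l.castSucc)
    have h' := hΦ.isDensity h
    exact h'

theorem trace_mul_unitaryChannel (V : unitaryGroup ι ℂ) (X Y : Matrix ι ι ℂ) :
    (X * unitaryChannel V Y).trace = (unitaryChannel (star V) X * Y).trace := by
  have h : ((star V : unitaryGroup ι ℂ) : Matrix ι ι ℂ) = (V : Matrix ι ι ℂ)ᴴ := rfl
  rw [unitaryChannel_apply, unitaryChannel_apply, h, conjTranspose_conjTranspose, ← mul_assoc,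
    trace_mul_comm]
  simp only [mul_assoc]

theorem unitaryChannel_ketbra (V : unitaryGroup ι ℂ) (w : ι → ℂ) :
    unitaryChannel V (ketbra w) = ketbra ((V : Matrix ι ι ℂ) *ᵥ w) := by
  rw [unitaryChannel_apply, ketbra, mul_vecMulVec, vecMulVec_mul, ketbra, star_mulVec]

theorem isPureState_iff_trace {w : ι → ℂ} : IsPureState w ↔ (ketbra w).trace = 1 := by
  refine ⟨trace_ketbra, fun h => ?_⟩
  have h2 := congrArg Complex.re h
  rw [ketbra, trace_vecMulVec, dotProduct, Complex.re_sum, Complex.one_re] at h2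
  rw [IsPureState, ← h2]
  refine Finset.sum_congr rfl fun i _ => ?_
  change _ = (w i * starRingEnd ℂ (w i)).re
  rw [Complex.mul_conj, Complex.normSq_eq_norm_sq,
    Complex.ofReal_re]

/-- A noisy circuit and its noiseless version have expectations differing by at most the diamond
distance of the noise to the identity, times the number of noise layers. -/
theorem IsCPTP.abs_trace_layeredCircuit_sub_le {Φ : SuperOp ι} (hΦ : IsCPTP Φ)
    {ρ : Matrix ι ι ℂ} (hρ : IsDensity ρ) (L : ℕ) (V : Fin L → unitaryGroup ι ℂ) {w : ι → ℂ}
    (hw : IsPureState w) :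
    |(ketbra w * layeredCircuit Φ L V ρ).trace.re
        - (ketbra w * layeredCircuit LinearMap.id L V ρ).trace.re|
      ≤ (L + 1) * diamondNorm (Φ - LinearMap.id) := by
  induction L generalizing w with
  | zero =>
    rw [Nat.cast_zero, zero_add, one_mul]
    exact hΦ.abs_trace_ketbra_mul_sub_le hw hρ
  | succ L ih =>
    have hσ := hΦ.isDensity_layeredCircuit hρ L fun l => V l.castSucc
    have h1 := hΦ.abs_trace_ketbra_mul_sub_le hw (isDensity_unitaryChannel (V (Fin.last L)) hσ)
    -- The last unitary is moved onto the test vector, which is why the induction keeps `w` general.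
    have hw' : IsPureState (((star (V (Fin.last L)) : unitaryGroup ι ℂ) : Matrix ι ι ℂ) *ᵥ w) := by
      rw [isPureState_iff_trace, ← unitaryChannel_ketbra]
      exact (isDensity_unitaryChannel _ (isDensity_ketbra hw)).trace_eq_one
    have h2 := ih (fun l => V l.castSucc) hw'
    rw [← unitaryChannel_ketbra, ← trace_mul_unitaryChannel, ← trace_mul_unitaryChannel] at h2
    have h3 := abs_add_le _ _ |>.trans (add_le_add h1 h2)
    rw [sub_add_sub_cancel] at h3
    push_cast
    refine le_trans h3 (le_of_eq ?_)
    ring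

/-- The definition peels off the last layer. Taking adjoints reverses the order, so the backward
circuit has to be peeled from its first layer. -/
theorem layeredCircuit_id_succ (L : ℕ) (V : Fin (L + 1) → unitaryGroup ι ℂ)
    (X : Matrix ι ι ℂ) :
    layeredCircuit LinearMap.id (L + 1) V X
      = layeredCircuit LinearMap.id L (fun l => V l.succ) (unitaryChannel (V 0) X) := by
  induction L with
  | zero => rfl
  | succ L ih =>
    change unitaryChannel (V (Fin.last (L + 1)))
      (layeredCircuit LinearMap.id (L + 1) (fun l => V l.castSucc) X) = _
    rw [ih fun l => V l.castSucc]
    rfl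

/-- The noiseless backward circuit is the adjoint of the noiseless forward circuit. -/
theorem trace_mul_forwardCircuit_id (L : ℕ) (U : Fin L → unitaryGroup ι ℂ)
    (X Y : Matrix ι ι ℂ) :
    (X * forwardCircuit LinearMap.id U Y).trace
      = (backwardCircuit LinearMap.id U X * Y).trace := by
  induction L generalizing X with
  | zero => rfl
  | succ L ih =>
    have h := ih (fun l => U l.castSucc) (unitaryChannel (star (U (Fin.last L))) X)
    rw [backwardCircuit, layeredCircuit_id_succ]
    simp only [Fin.rev_succ, Fin.rev_zero]
    rw [backwardCircuit] at h
    rw [← h, ← trace_mul_unitaryChannel]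
    rfl

/-- The forward circuit and the adjoint of the backward circuit agree up to the noise. -/
theorem abs_trace_forwardCircuit_sub_le {M K : SuperOp ι} (hM : IsCPTP M) (hK : IsCPTP K)
    {L : ℕ} (U : Fin L → unitaryGroup ι ℂ) {v w : ι → ℂ} (hv : IsPureState v)
    (hw : IsPureState w) :
    |(ketbra v * forwardCircuit M U (ketbra w)).trace.re
      - (ketbra w * backwardCircuit K U (ketbra v)).trace.re|
    ≤ (L + 1) * (diamondNorm (M - LinearMap.id) + diamondNorm (K - LinearMap.id)) := by
  have h1 := hM.abs_trace_layeredCircuit_sub_le (isDensity_ketbra hw) L U hv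
  have h2 := hK.abs_trace_layeredCircuit_sub_le (isDensity_ketbra hv) L
    (fun l => star (U l.rev)) hw
  have h3 := congrArg Complex.re (trace_mul_forwardCircuit_id L U (ketbra v) (ketbra w))
  rw [trace_mul_comm (backwardCircuit _ _ _)] at h3
  rw [forwardCircuit, backwardCircuit] at *
  rw [abs_le] at *
  constructor <;> linarith [h1.1, h1.2, h2.1, h2.2]

end Channel

/-! ### Single-qubit reductions and overlaps with product states -/

section Reduction

/-- An orthonormal basis of a qubit that contains a given unit vector. -/
def qubitBasis (φ : Fin 2 → ℂ) : Fin 2 → Fin 2 → ℂ := ![φ, ![-star (φ 1), star (φ 0)]]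

theorem qubitBasis_complete {φ : Fin 2 → ℂ} (hφ : IsPureState φ) (x y : Fin 2) :
    ∑ a, qubitBasis φ a x * star (qubitBasis φ a y) = if x = y then 1 else 0 := by
  have h := trace_ketbra hφ
  rw [ketbra, trace_vecMulVec, dotProduct, Fin.sum_univ_two] at h
  change φ 0 * starRingEnd ℂ (φ 0) + φ 1 * starRingEnd ℂ (φ 1) = 1 at h
  rw [Fin.sum_univ_two]
  fin_cases x <;> fin_cases y <;> simp [qubitBasis]
  · linear_combination h
  · ring
  · ring
  · linear_combination h

variable {N : ℕ}

/-- The elements of the product basis built from the bases `qubitBasis (φ n)`. -/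
def productBasis (φ : Fin N → Fin 2 → ℂ) (t : Register N) : Register N → ℂ :=
  productKet fun n => qubitBasis (φ n) (t n)

theorem productBasis_zero (φ : Fin N → Fin 2 → ℂ) : productBasis φ 0 = productKet φ := rfl

/-- Weights that factor over the qubits let the sum over basis strings factor too. Constant weights
yield the resolution of the identity; the indicator of outcome 0 at one qubit yields `|φ n⟩⟨φ n|`
there and the identity elsewhere. -/
theorem sum_smul_ketbra_productBasis (φ : Fin N → Fin 2 → ℂ) (c : Fin N → Fin 2 → ℂ)
    (s s' : Register N) :
    (∑ t : Register N, (∏ m, c m (t m)) • ketbra (productBasis φ t)) s s'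
      = ∏ m, ∑ a, c m a * (qubitBasis (φ m) a (s m) * star (qubitBasis (φ m) a (s' m))) := by
  rw [Finset.prod_univ_sum, Fintype.piFinset_univ, Matrix.sum_apply]
  refine Finset.sum_congr rfl fun t _ => ?_
  simp only [Matrix.smul_apply, smul_eq_mul, ketbra, vecMulVec_apply, Pi.star_apply, productBasis,
    productKet, star_prod, Finset.prod_mul_distrib]

theorem sum_ketbra_productBasis {φ : Fin N → Fin 2 → ℂ} (hφ : ∀ n, IsPureState (φ n)) :
    ∑ t : Register N, ketbra (productBasis φ t) = 1 := by
  ext s s'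
  have h := sum_smul_ketbra_productBasis φ (fun _ _ => 1) s s'
  simp only [Finset.prod_const_one, one_smul, one_mul, qubitBasis_complete (hφ _)] at h
  rw [h, one_apply, Finset.prod_ite_zero]
  simp [funext_iff]

theorem sum_filter_ketbra_productBasis {φ : Fin N → Fin 2 → ℂ} (hφ : ∀ n, IsPureState (φ n))
    (n : Fin N) (s s' : Register N) :
    (∑ t : Register N with t n = 0, ketbra (productBasis φ t)) s s'
      = ∏ m, if m = n then φ n (s n) * star (φ n (s' n)) else if s m = s' m then 1 else 0 := by
  have h := sum_smul_ketbra_productBasis φ (fun m a => if m = n ∧ a ≠ 0 then 0 else 1) s s'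
  have h1 (t : Register N) : (∏ m, if m = n ∧ t m ≠ 0 then (0 : ℂ) else 1)
      = if t n = 0 then 1 else 0 := by
    split_ifs with ht
    · exact Finset.prod_eq_one fun m _ => if_neg (by rintro ⟨rfl, hm⟩; exact hm ht)
    · exact Finset.prod_eq_zero (Finset.mem_univ n) (if_pos ⟨rfl, ht⟩)
  simp only [h1, ite_smul, one_smul, zero_smul] at h
  rw [Finset.sum_filter, h]
  refine Finset.prod_congr rfl fun m _ => ?_
  split_ifs with hm h2
  · subst hm
    simp [qubitBasis]
  · simp only [hm, false_and, if_false, one_mul, qubitBasis_complete (hφ m), if_pos h2]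
  · simp only [hm, false_and, if_false, one_mul, qubitBasis_complete (hφ m), if_neg h2]

theorem trace_ketbra_mul_reducedQubit (χ : Fin 2 → ℂ) (ρ : Matrix (Register N) (Register N) ℂ)
    (n : Fin N) :
    (ketbra χ * reducedQubit ρ n).trace
      = ∑ s, ∑ a, χ a * star (χ (s n)) * ρ s (Function.update s n a) := by
  simp only [trace, diag_apply, mul_apply, ketbra, vecMulVec_apply, reducedQubit, of_apply,
    Pi.star_apply, Finset.mul_sum, mul_ite, mul_zero]
  rw [Finset.sum_comm]
  refine (Finset.sum_congr rfl fun b _ => Finset.sum_comm).trans ?_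
  rw [Finset.sum_comm]
  refine Finset.sum_congr rfl fun s _ => ?_
  rw [Finset.sum_comm]
  refine Finset.sum_congr rfl fun a _ => ?_
  simp

theorem trace_sum_filter_mul {φ : Fin N → Fin 2 → ℂ} (hφ : ∀ n, IsPureState (φ n))
    (ρ : Matrix (Register N) (Register N) ℂ) (n : Fin N) :
    ((∑ t : Register N with t n = 0, ketbra (productBasis φ t)) * ρ).trace
      = (ketbra (φ n) * reducedQubit ρ n).trace := by
  rw [trace_ketbra_mul_reducedQubit]
  simp only [trace, diag_apply, mul_apply, sum_filter_ketbra_productBasis hφ]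
  rw [Finset.sum_comm]
  refine Finset.sum_congr rfl fun s' _ => ?_
  symm
  -- Only strings that agree with `s'` away from qubit `n` contribute.
  refine Fintype.sum_of_injective (Function.update s' n) (Function.update_injective s' n) _ _
    (fun s hs => ?_) fun a => ?_
  · obtain ⟨m, hm, hne⟩ : ∃ m, m ≠ n ∧ s m ≠ s' m := by
      by_contra! hcon
      refine hs ⟨s n, ?_⟩
      ext m
      by_cases hm : m = n
      · subst hm; simp
      · simp [hm, hcon m hm]
    rw [Finset.prod_eq_zero (Finset.mem_univ m) (by simp [hm, hne]), zero_mul]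
  · congr 1
    rw [Finset.prod_eq_single n]
    · simp
    · intro m _ hm
      simp [hm]
    · simp

theorem trace_ketbra_mul_re_nonneg {ι : Type} [Fintype ι] [DecidableEq ι]
    {ρ : Matrix ι ι ℂ} (hρ : ρ.PosSemidef) (w : ι → ℂ) :
    0 ≤ (ketbra w * ρ).trace.re := by
  rw [trace_ketbra_mul]
  exact (Complex.le_def.1 (hρ.dotProduct_mulVec_nonneg w)).1

variable {ρ : Matrix (Register N) (Register N) ℂ} {φ : Fin N → Fin 2 → ℂ}

theorem sum_overlap_productBasis (hρ : IsDensity ρ) (hφ : ∀ n, IsPureState (φ n)) :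
    ∑ t, (ketbra (productBasis φ t) * ρ).trace.re = 1 := by
  rw [← Complex.re_sum, ← trace_sum, ← Finset.sum_mul, sum_ketbra_productBasis hφ, one_mul,
    hρ.trace_eq_one, Complex.one_re]

theorem sum_filter_overlap_productBasis (hφ : ∀ n, IsPureState (φ n)) (n : Fin N) :
    ∑ t : Register N with t n = 0, (ketbra (productBasis φ t) * ρ).trace.re
      = (ketbra (φ n) * reducedQubit ρ n).trace.re := by
  rw [← Complex.re_sum, ← trace_sum, ← Finset.sum_mul, trace_sum_filter_mul hφ]

/-- The overlap with a product state is at most the overlap of each single-qubit reduction. -/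
theorem overlap_productKet_le (hρ : IsDensity ρ) (hφ : ∀ n, IsPureState (φ n)) (n : Fin N) :
    (ketbra (productKet φ) * ρ).trace.re ≤ (ketbra (φ n) * reducedQubit ρ n).trace.re := by
  rw [← sum_filter_overlap_productBasis hφ n, ← productBasis_zero]
  exact Finset.single_le_sum
    (f := fun t : Register N => (ketbra (productBasis φ t) * ρ).trace.re)
    (fun t _ => trace_ketbra_mul_re_nonneg hρ.posSemidef _) (by simp)

/-- The infidelity with a product state is at most the sum of the single-qubit infidelities. -/
theorem one_sub_overlap_productKet_le (hρ : IsDensity ρ) (hφ : ∀ n, IsPureState (φ n)) :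
    1 - (ketbra (productKet φ) * ρ).trace.re
      ≤ ∑ n, (1 - (ketbra (φ n) * reducedQubit ρ n).trace.re) := by
  set p : Register N → ℝ := fun t => (ketbra (productBasis φ t) * ρ).trace.re with hp
  have hp0 (t) : 0 ≤ p t := trace_ketbra_mul_re_nonneg hρ.posSemidef _
  have hsum : ∑ t, p t = 1 := sum_overlap_productBasis hρ hφ
  have hn (n : Fin N) : 1 - (ketbra (φ n) * reducedQubit ρ n).trace.re
      = ∑ t, if t n = 0 then 0 else p t := by
    rw [← sum_filter_overlap_productBasis hφ n, ← hsum, Finset.sum_filter, ← Finset.sum_sub_distrib]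
    refine Finset.sum_congr rfl fun t _ => ?_
    split_ifs <;> simp [hp]
  have h0 : 1 - (ketbra (productKet φ) * ρ).trace.re = ∑ t, if t = 0 then 0 else p t := by
    have : (ketbra (productKet φ) * ρ).trace.re = ∑ t, if t = 0 then p t else 0 := by
      rw [Finset.sum_ite_eq' Finset.univ 0 p, if_pos (Finset.mem_univ _)]
      rfl
    rw [this, ← hsum, ← Finset.sum_sub_distrib]
    refine Finset.sum_congr rfl fun t _ => ?_
    split_ifs <;> simp
  simp only [h0, hn]
  rw [Finset.sum_comm]
  -- Union bound: a nonzero outcome string is nonzero at some qubit, so its probability is counted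
  -- at least once on the right.
  refine Finset.sum_le_sum fun t _ => ?_
  have hterm (n : Fin N) : 0 ≤ if t n = 0 then 0 else p t := by
    split_ifs
    exacts [le_rfl, hp0 t]
  split_ifs with ht
  · exact Finset.sum_nonneg fun n _ => hterm n
  · obtain ⟨n, hn⟩ := Function.ne_iff.1 ht
    refine le_trans (le_of_eq ?_)
      (Finset.single_le_sum (f := fun n => if t n = 0 then 0 else p t)
        (fun n _ => hterm n) (Finset.mem_univ n))
    exact (if_neg hn).symm

/-- The partial trace is a sum of principal submatrices of `ρ`, one for each configuration of the
other qubits; the condition `s n = 0` selects one representative of each. -/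
theorem isDensity_reducedQubit (hρ : IsDensity ρ) (n : Fin N) :
    IsDensity (reducedQubit ρ n) := by
  constructor
  · have h : reducedQubit ρ n
        = ∑ s : Register N with s n = 0, ρ.submatrix (Function.update s n) (Function.update s n) := by
      ext a b
      simp only [reducedQubit, of_apply, Matrix.sum_apply, submatrix_apply]
      rw [← Finset.sum_filter]
      refine Finset.sum_nbij' (fun s : Register N => (Function.update s n 0 : Register N))
        (fun s : Register N => (Function.update s n a : Register N)) ?_ ?_ ?_ ?_ ?_
      · simp
      · simp
      · intro s hs
        simp only [Finset.mem_filter, Finset.mem_univ, true_and] at hs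
        simp [← hs]
      · intro s hs
        simp only [Finset.mem_filter, Finset.mem_univ, true_and] at hs
        simp [← hs]
      · intro s hs
        simp only [Finset.mem_filter, Finset.mem_univ, true_and] at hs
        simp [← hs]
    rw [h]
    exact posSemidef_sum _ fun s _ => hρ.posSemidef.submatrix _
  · rw [← hρ.trace_eq_one]
    simp only [trace, diag_apply, reducedQubit, of_apply]
    rw [Finset.sum_comm]
    refine Finset.sum_congr rfl fun s _ => ?_
    simp

end Reduction

/-! ### Qubits -/

section Qubit

/-- The length of the Bloch vector of a qubit. -/
noncomputable def blochRadius (ρ : Matrix (Fin 2) (Fin 2) ℂ) : ℝ :=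
  √(4 * ‖ρ 1 0‖ ^ 2 + ((ρ 0 0).re - (ρ 1 1).re) ^ 2)

theorem blochRadius_nonneg (ρ : Matrix (Fin 2) (Fin 2) ℂ) : 0 ≤ blochRadius ρ := Real.sqrt_nonneg _

theorem blochRadius_sq (ρ : Matrix (Fin 2) (Fin 2) ℂ) :
    blochRadius ρ ^ 2 = 4 * ‖ρ 1 0‖ ^ 2 + ((ρ 0 0).re - (ρ 1 1).re) ^ 2 :=
  Real.sq_sqrt (by positivity)

variable {ρ : Matrix (Fin 2) (Fin 2) ℂ}

theorem IsDensity.qubit_entries (hρ : IsDensity ρ) :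
    ρ 0 1 = starRingEnd ℂ (ρ 1 0) ∧ (ρ 0 0).im = 0 ∧ (ρ 1 1).im = 0 ∧
      (ρ 0 0).re + (ρ 1 1).re = 1 := by
  have h := hρ.posSemidef.isHermitian
  have ht := congrArg Complex.re hρ.trace_eq_one
  rw [trace_fin_two, Complex.add_re, Complex.one_re] at ht
  exact ⟨(h.apply 0 1).symm, Complex.conj_eq_iff_im.1 (h.apply 0 0),
    Complex.conj_eq_iff_im.1 (h.apply 1 1), ht⟩

/-- At trace one, the determinant is `(1 - r ^ 2) / 4`, and positivity makes it nonnegative. -/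
theorem IsDensity.blochRadius_le_one (hρ : IsDensity ρ) : blochRadius ρ ≤ 1 := by
  obtain ⟨h01, h0, h1, ht⟩ := hρ.qubit_entries
  have hdet := (Complex.le_def.1 hρ.posSemidef.det_nonneg).1
  rw [det_fin_two, h01, ← Complex.normSq_eq_conj_mul_self, Complex.normSq_eq_norm_sq] at hdet
  simp only [Complex.sub_re, Complex.mul_re, h0, h1, Complex.ofReal_re, Complex.zero_re] at hdet
  have := blochRadius_sq ρ
  have hb : (ρ 1 1).re = 1 - (ρ 0 0).re := by linarith
  rw [hb] at this hdet
  refine (abs_le_one_iff_mul_self_le_one.2 ?_ |> le_trans (le_abs_self _))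
  nlinarith

theorem IsDensity.trace_mul_self_qubit (hρ : IsDensity ρ) :
    (ρ * ρ).trace.re = (1 + blochRadius ρ ^ 2) / 2 := by
  obtain ⟨h01, h0, h1, ht⟩ := hρ.qubit_entries
  have e : (ρ * ρ).trace = ρ 0 0 * ρ 0 0 + ρ 1 1 * ρ 1 1 + 2 * (starRingEnd ℂ (ρ 1 0) * ρ 1 0) := by
    rw [trace_fin_two, mul_apply, mul_apply, Fin.sum_univ_two, Fin.sum_univ_two, h01]
    ring
  rw [e, blochRadius_sq, ← Complex.normSq_eq_conj_mul_self, Complex.normSq_eq_norm_sq]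
  simp only [Complex.add_re, Complex.mul_re, h0, h1, Complex.ofReal_re, Complex.re_ofNat,
    Complex.im_ofNat]
  have hb : (ρ 1 1).re = 1 - (ρ 0 0).re := by linarith
  rw [hb]
  ring

theorem IsDensity.trace_ketbra_mul_qubit (hρ : IsDensity ρ) (φ : Fin 2 → ℂ) :
    (ketbra φ * ρ).trace.re = ‖φ 0‖ ^ 2 * (ρ 0 0).re + ‖φ 1‖ ^ 2 * (ρ 1 1).re
      + 2 * (φ 0 * starRingEnd ℂ (φ 1) * ρ 1 0).re := by
  obtain ⟨h01, h0, h1, ht⟩ := hρ.qubit_entries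
  rw [trace_fin_two, mul_apply, mul_apply, Fin.sum_univ_two, Fin.sum_univ_two, h01,
    ← Complex.normSq_eq_norm_sq, ← Complex.normSq_eq_norm_sq, Complex.normSq_apply,
    Complex.normSq_apply]
  simp [ketbra, vecMulVec_apply, h0, h1]
  ring

/-- The largest overlap of a qubit with a pure state is `(1 + r) / 2`, `r` the Bloch radius. -/
theorem IsDensity.overlap_qubit_le (hρ : IsDensity ρ) {φ : Fin 2 → ℂ} (hφ : IsPureState φ) :
    (ketbra φ * ρ).trace.re ≤ (1 + blochRadius ρ) / 2 := by
  obtain ⟨h01, h0, h1, ht⟩ := hρ.qubit_entries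
  rw [hρ.trace_ketbra_mul_qubit]
  have hn : ‖φ 0‖ ^ 2 + ‖φ 1‖ ^ 2 = 1 := by
    rw [← Fin.sum_univ_two fun i => ‖φ i‖ ^ 2]; exact hφ
  have hre : (φ 0 * starRingEnd ℂ (φ 1) * ρ 1 0).re ≤ ‖φ 0‖ * ‖φ 1‖ * ‖ρ 1 0‖ := by
    refine (Complex.re_le_norm _).trans (le_of_eq ?_)
    rw [norm_mul, norm_mul, RCLike.norm_conj]
  set x := ‖φ 0‖
  set y := ‖φ 1‖
  set c := ‖ρ 1 0‖
  set z := (ρ 0 0).re - (ρ 1 1).re with hz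
  have key : (x ^ 2 - y ^ 2) * z + 4 * (x * y) * c ≤ blochRadius ρ := by
    refine le_trans (le_abs_self _) (abs_le_of_sq_le_sq ?_ (blochRadius_nonneg ρ))
    rw [blochRadius_sq]
    -- Cauchy–Schwarz for the unit vector `(x² - y², 2xy)` against `(z, 2c)`, with `h3` the square
    -- in Lagrange's identity.
    have h2 : (x ^ 2 - y ^ 2) ^ 2 + (2 * x * y) ^ 2 = 1 := by
      linear_combination (x ^ 2 + y ^ 2 + 1) * hn
    have h3 : 0 ≤ ((x ^ 2 - y ^ 2) * (2 * c) - 2 * x * y * z) ^ 2 := sq_nonneg _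
    linear_combination h3 + (4 * c ^ 2 + z ^ 2) * h2
  have ha : (ρ 0 0).re = (1 + z) / 2 := by linarith
  have hb : (ρ 1 1).re = (1 - z) / 2 := by linarith
  rw [ha, hb]
  linarith

theorem isPureState_rotatedKet (β γ : ℝ) : IsPureState (rotatedKet β γ) := by
  have h1 : ‖Complex.exp (-(Complex.I * β / 2))‖ = 1 := by
    rw [Complex.norm_exp]; simp
  have h2 : ‖Complex.exp (Complex.I * β / 2)‖ = 1 := by
    rw [Complex.norm_exp]; simp
  rw [IsPureState, Fin.sum_univ_two]
  simp only [rotatedKet, cons_val_zero, cons_val_one, norm_mul, h1, h2, one_mul, Complex.norm_real,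
    Real.norm_eq_abs, sq_abs]
  exact Real.cos_sq_add_sin_sq _

/-- The pure state constructed from a qubit attains the largest overlap. -/
theorem IsDensity.overlap_rotatedKet (hρ : IsDensity ρ) :
    (ketbra (rotatedKet (qubitBeta ρ) (qubitGamma ρ)) * ρ).trace.re
      = (1 + blochRadius ρ) / 2 := by
  obtain ⟨h01, h0, h1, ht⟩ := hρ.qubit_entries
  have n1 : ‖Complex.exp (-(Complex.I * qubitBeta ρ / 2))‖ = 1 := by
    rw [Complex.norm_exp]; simp
  have n2 : ‖Complex.exp (Complex.I * qubitBeta ρ / 2)‖ = 1 := by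
    rw [Complex.norm_exp]; simp
  have hprod : rotatedKet (qubitBeta ρ) (qubitGamma ρ) 0 *
      starRingEnd ℂ (rotatedKet (qubitBeta ρ) (qubitGamma ρ) 1) * ρ 1 0
      = ((Real.cos (qubitGamma ρ / 2) * Real.sin (qubitGamma ρ / 2) * ‖ρ 1 0‖ : ℝ) : ℂ) := by
    have hc : starRingEnd ℂ (Complex.exp (Complex.I * qubitBeta ρ / 2))
        = Complex.exp (-(Complex.I * qubitBeta ρ / 2)) := by
      rw [← Complex.exp_conj]
      congr 1
      simp [map_div₀, Complex.conj_ofNat, neg_div]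
    -- The angle `β = arg ρ₁₀` cancels the phase of the off-diagonal entry.
    have he : Complex.exp (-(Complex.I * qubitBeta ρ / 2)) *
        Complex.exp (-(Complex.I * qubitBeta ρ / 2)) * ρ 1 0 = ‖ρ 1 0‖ := by
      conv_lhs => rw [← Complex.norm_mul_exp_arg_mul_I (ρ 1 0)]
      rw [← Complex.exp_add, mul_left_comm, ← Complex.exp_add, qubitBeta]
      ring_nf
      simp
    simp only [rotatedKet, cons_val_zero, cons_val_one, map_mul, hc, Complex.conj_ofReal]
    push_cast
    linear_combination (Complex.cos (qubitGamma ρ / 2) * Complex.sin (qubitGamma ρ / 2)) * he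
  rw [hρ.trace_ketbra_mul_qubit, hprod, Complex.ofReal_re]
  simp only [rotatedKet, cons_val_zero, cons_val_one, norm_mul, n1, n2, one_mul, Complex.norm_real,
    Real.norm_eq_abs, sq_abs]
  set γ := qubitGamma ρ with hγ
  set r := blochRadius ρ with hr
  set c := ‖ρ 1 0‖ with hc
  set z := (ρ 0 0).re - (ρ 1 1).re with hz
  have hr2 : r ^ 2 = 4 * c ^ 2 + z ^ 2 := blochRadius_sq ρ
  have hr0 : 0 ≤ r := blochRadius_nonneg ρ
  have hc0 : 0 ≤ c := norm_nonneg _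
  have hγ' : γ = Real.pi / 2 - Real.arcsin (z / r) := rfl
  have hzr : |z| ≤ r := abs_le_of_sq_le_sq' (by nlinarith) hr0 |> abs_le.2
  have hcos : Real.cos γ * r = z := by
    -- For `r = 0` also `z = 0`, so the identity holds whatever angle the division by zero produces.
    rcases hr0.eq_or_lt with h | h
    · rw [← h] at hzr ⊢
      rw [abs_nonpos_iff.1 hzr, mul_zero]
    · rw [hγ', Real.cos_pi_div_two_sub, Real.sin_arcsin, div_mul_cancel₀ _ h.ne']
      · rw [le_div_iff₀ h]; linarith [neg_abs_le z]
      · rw [div_le_one h]; linarith [le_abs_self z]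
  have hsin0 : 0 ≤ Real.sin γ := by
    rw [hγ', Real.sin_pi_div_two_sub]; exact Real.cos_arcsin_nonneg _
  have hsin : Real.sin γ * r = 2 * c := by
    refine (sq_eq_sq₀ (by positivity) (by positivity)).1 ?_
    have := Real.sin_sq_add_cos_sq γ
    have h3 : (Real.cos γ * r) ^ 2 = z ^ 2 := by rw [hcos]
    nlinarith
  have hfin : Real.cos γ * z + Real.sin γ * (2 * c) = r := by
    rw [← hcos, ← hsin]
    linear_combination r * Real.sin_sq_add_cos_sq γ
  have ha : (ρ 0 0).re = (1 + z) / 2 := by linarith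
  have hb : (ρ 1 1).re = (1 - z) / 2 := by linarith
  have hγ2 : γ = 2 * (γ / 2) := by ring
  rw [hγ2, Real.cos_two_mul, Real.sin_two_mul] at hfin
  rw [ha, hb]
  linear_combination hfin / 2 + (1 - z) / 2 * Real.sin_sq_add_cos_sq (γ / 2)

end Qubit

/-! ### The Bloch radius as a function of the entropy -/

section Entropy

/-- The Bloch radius of a qubit of Rényi-2 entropy `s`. -/
noncomputable def radiusOfEntropy (s : ℝ) : ℝ := √((2 : ℝ) ^ (1 - s) - 1)

theorem radiusOfEntropy_zero : radiusOfEntropy 0 = 1 := by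
  rw [radiusOfEntropy, sub_zero, Real.rpow_one]
  norm_num

theorem radiusOfEntropy_one : radiusOfEntropy 1 = 0 := by
  simp [radiusOfEntropy]

theorem radiusOfEntropy_antitone : Antitone radiusOfEntropy := fun s t h =>
  Real.sqrt_le_sqrt (sub_le_sub_right
    (Real.rpow_le_rpow_of_exponent_le one_le_two (by linarith)) 1)

theorem hasDerivAt_radiusOfEntropy {s : ℝ} (hs : s < 1) :
    HasDerivAt radiusOfEntropy
      (-(Real.log 2 / 2) * ((1 + radiusOfEntropy s ^ 2) / radiusOfEntropy s)) s := by
  have h1 : (1 : ℝ) < 2 ^ (1 - s) := Real.one_lt_rpow one_lt_two (by linarith)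
  have hsq : radiusOfEntropy s ^ 2 = 2 ^ (1 - s) - 1 := Real.sq_sqrt (by linarith)
  have hd : HasDerivAt (fun t : ℝ => (2 : ℝ) ^ (1 - t) - 1) (Real.log 2 * (-1) * 2 ^ (1 - s)) s :=
    (((hasDerivAt_id s).const_sub 1).const_rpow two_pos).sub_const 1
  have hd' : HasDerivAt radiusOfEntropy _ s := hd.sqrt (by linarith)
  convert hd' using 1
  rw [hsq, radiusOfEntropy]
  ring

/-- The slope is a negative multiple of `(1 + r ^ 2) / r`, which decreases in `r` on `(0, 1]`; since
`r` decreases with the entropy, so does the slope. -/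
theorem concaveOn_radiusOfEntropy : ConcaveOn ℝ (Set.Icc 0 1) radiusOfEntropy := by
  refine AntitoneOn.concaveOn_of_deriv (convex_Icc 0 1) ?_ ?_ ?_
  · refine Continuous.continuousOn (Real.continuous_sqrt.comp ?_)
    exact (Real.continuous_const_rpow two_ne_zero |>.comp (continuous_const.sub continuous_id)).sub
      continuous_const
  · rw [interior_Icc]
    exact fun s hs => (hasDerivAt_radiusOfEntropy hs.2).differentiableAt.differentiableWithinAt
  · rw [interior_Icc]
    intro s hs t ht hst
    rw [(hasDerivAt_radiusOfEntropy hs.2).deriv, (hasDerivAt_radiusOfEntropy ht.2).deriv]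
    have hpos {u : ℝ} (hu : u < 1) : 0 < radiusOfEntropy u :=
      Real.sqrt_pos.2 (sub_pos.2 (Real.one_lt_rpow one_lt_two (by linarith)))
    have hp := hpos hs.2
    have hq := hpos ht.2
    have hqp := radiusOfEntropy_antitone hst
    have hp1 : radiusOfEntropy s ≤ 1 := radiusOfEntropy_zero ▸ radiusOfEntropy_antitone hs.1.le
    refine mul_le_mul_of_nonpos_left ?_ (by linarith [Real.log_pos one_lt_two])
    rw [div_le_div_iff₀ hp hq]
    -- For radii `p ≥ q`, the difference of the two sides is `(p - q) * (1 - p * q)`.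
    nlinarith [mul_nonneg (sub_nonneg.2 hqp)
      (sub_nonneg.2 (mul_le_one₀ hp1 hq.le (hqp.trans hp1)))]

/-- A concave function has a larger sum at the inner two of four points with equal sums. -/
theorem add_le_add_of_concaveOn {D : Set ℝ} {f : ℝ → ℝ} (hf : ConcaveOn ℝ D f) {a b c d : ℝ}
    (ha : a ∈ D) (hb : b ∈ D) (hac : a ≤ c) (had : a ≤ d) (h : a + b = c + d) :
    f a + f b ≤ f c + f d := by
  rcases hac.eq_or_lt with rfl | hac'
  · rw [add_left_cancel h]
  have hab : 0 < b - a := by linarith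
  have e1 : (b - c) / (b - a) + (c - a) / (b - a) = 1 := by field_simp; ring
  have p1 : 0 ≤ (b - c) / (b - a) := div_nonneg (by linarith) hab.le
  have p2 : 0 ≤ (c - a) / (b - a) := div_nonneg (by linarith) hab.le
  have k1 := hf.2 ha hb p1 p2 e1
  have k2 := hf.2 hb ha p1 p2 e1
  simp only [smul_eq_mul] at k1 k2
  have ec : (b - c) / (b - a) * a + (c - a) / (b - a) * b = c := by field_simp; ring
  have ed : (b - c) / (b - a) * b + (c - a) / (b - a) * a = d := by
    have : d = a + b - c := by linarith
    rw [this]; field_simp; ring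
  rw [ec] at k1
  rw [ed] at k2
  have : (b - c) / (b - a) * f a + (c - a) / (b - a) * f b
      + ((b - c) / (b - a) * f b + (c - a) / (b - a) * f a) = f a + f b := by
    linear_combination (f a + f b) * e1
  linarith

/-- The floor counts maximally mixed qubits, each of infidelity 1/2; one further qubit carries the
fractional entropy. -/
theorem fUpper_eq (S : ℝ) : fUpper S = (1 - radiusOfEntropy (Int.fract S) + ⌊S⌋) / 2 := by
  rw [fUpper, radiusOfEntropy, Int.fract, ← sub_add]

/-- Adding a qubit of entropy `x` to the extremal configuration. By concavity the pair `(fract T,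
x)` can be spread, at fixed sum, to `(0, fract T + x)`, or to `(fract T + x - 1, 1)` when the sum
reaches 1 and the floor goes up. -/
theorem fUpper_add_le (T : ℝ) {x : ℝ} (hx0 : 0 ≤ x) (hx1 : x ≤ 1) :
    fUpper T + (1 - radiusOfEntropy x) / 2 ≤ fUpper (T + x) := by
  have hf0 := Int.fract_nonneg T
  have hf1 := Int.fract_lt_one T
  have hT := Int.floor_add_fract T
  rw [fUpper_eq, fUpper_eq]
  rcases lt_or_ge (Int.fract T + x) 1 with h | h
  · have hfl : ⌊T + x⌋ = ⌊T⌋ := Int.floor_eq_iff.2 ⟨by linarith, by linarith⟩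
    have hfr : Int.fract (T + x) = Int.fract T + x := by
      rw [Int.fract, hfl]; linarith
    have k := add_le_add_of_concaveOn concaveOn_radiusOfEntropy (a := 0) (b := Int.fract T + x)
      (by simp) ⟨by linarith, h.le⟩ hf0 hx0 (zero_add _)
    rw [radiusOfEntropy_zero] at k
    rw [hfr, hfl]
    linarith
  · have hfl : ⌊T + x⌋ = ⌊T⌋ + 1 :=
      Int.floor_eq_iff.2 ⟨by push_cast; linarith, by push_cast; linarith⟩
    have hfr : Int.fract (T + x) = Int.fract T + x - 1 := by
      rw [Int.fract, hfl]; push_cast; linarith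
    have k := add_le_add_of_concaveOn concaveOn_radiusOfEntropy (a := Int.fract T + x - 1) (b := 1)
      (c := Int.fract T) (d := x) ⟨by linarith, by linarith⟩ (by simp) (by linarith) (by linarith)
      (by ring)
    rw [radiusOfEntropy_one] at k
    rw [hfr, hfl]
    push_cast
    linarith

theorem sum_one_sub_radiusOfEntropy_le {κ : Type} (s : Finset κ) (x : κ → ℝ)
    (hx0 : ∀ n ∈ s, 0 ≤ x n) (hx1 : ∀ n ∈ s, x n ≤ 1) :
    ∑ n ∈ s, (1 - radiusOfEntropy (x n)) / 2 ≤ fUpper (∑ n ∈ s, x n) := by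
  classical
  induction s using Finset.induction_on with
  | empty => simp [fUpper_eq, radiusOfEntropy_zero]
  | insert a s ha ih =>
    rw [Finset.sum_insert ha, Finset.sum_insert ha, add_comm, add_comm (x a)]
    refine le_trans (add_le_add_left (ih (fun n hn => hx0 n (Finset.mem_insert_of_mem hn))
      fun n hn => hx1 n (Finset.mem_insert_of_mem hn)) _) (fUpper_add_le _ ?_ ?_)
    · exact hx0 a (Finset.mem_insert_self a s)
    · exact hx1 a (Finset.mem_insert_self a s)

variable {ρ : Matrix (Fin 2) (Fin 2) ℂ}

theorem IsDensity.two_rpow_renyiTwo (hρ : IsDensity ρ) :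
    (2 : ℝ) ^ (-renyiTwo ρ) = (1 + blochRadius ρ ^ 2) / 2 := by
  rw [renyiTwo, neg_neg, hρ.trace_mul_self_qubit]
  exact Real.rpow_logb two_pos (by norm_num) (by positivity)

theorem IsDensity.radiusOfEntropy_renyiTwo (hρ : IsDensity ρ) :
    radiusOfEntropy (renyiTwo ρ) = blochRadius ρ := by
  rw [radiusOfEntropy, sub_eq_add_neg 1 (renyiTwo ρ), Real.rpow_add two_pos, Real.rpow_one,
    hρ.two_rpow_renyiTwo, mul_div_cancel₀ _ two_ne_zero, add_sub_cancel_left,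
    Real.sqrt_sq (blochRadius_nonneg ρ)]

theorem IsDensity.renyiTwo_nonneg (hρ : IsDensity ρ) : 0 ≤ renyiTwo ρ := by
  have h := hρ.two_rpow_renyiTwo
  have h1 : (2 : ℝ) ^ (-renyiTwo ρ) ≤ 2 ^ (0 : ℝ) := by
    rw [h, Real.rpow_zero]
    nlinarith [blochRadius_nonneg ρ, hρ.blochRadius_le_one]
  linarith [(Real.rpow_le_rpow_left_iff one_lt_two).1 h1]

theorem IsDensity.renyiTwo_le_one (hρ : IsDensity ρ) : renyiTwo ρ ≤ 1 := by
  have h := hρ.two_rpow_renyiTwo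
  have h1 : (2 : ℝ) ^ (-1 : ℝ) ≤ 2 ^ (-renyiTwo ρ) := by
    rw [h, Real.rpow_neg_one]
    nlinarith [sq_nonneg (blochRadius ρ)]
  linarith [(Real.rpow_le_rpow_left_iff one_lt_two).1 h1]

end Entropy

/-! ### Overlaps with product states in terms of the entanglement measure -/

section Overlap

variable {N : ℕ} {ρ : Matrix (Register N) (Register N) ℂ}

/-- A qubit with at least the average entropy exists, and its overlap alone limits that of the whole
product state. -/
theorem fLower_le_one_sub_overlap (hN : 1 ≤ N) (hρ : IsDensity ρ) {φ : Fin N → Fin 2 → ℂ}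
    (hφ : ∀ n, IsPureState (φ n)) :
    fLower N (entanglementMeasure ρ) ≤ 1 - (ketbra (productKet φ) * ρ).trace.re := by
  have : Nonempty (Fin N) := ⟨⟨0, hN⟩⟩
  obtain ⟨n, -, hn⟩ : ∃ n ∈ Finset.univ,
      entanglementMeasure ρ / N ≤ renyiTwo (reducedQubit ρ n) := by
    refine Finset.exists_le_of_sum_le Finset.univ_nonempty (le_of_eq ?_)
    have : (N : ℝ) ≠ 0 := by positivity
    simp [entanglementMeasure]
    field_simp
  have hd := isDensity_reducedQubit hρ n
  have h1 := (overlap_productKet_le hρ hφ n).trans (hd.overlap_qubit_le (hφ n))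
  have h2 := radiusOfEntropy_antitone hn
  rw [hd.radiusOfEntropy_renyiTwo] at h2
  rw [fLower, ← radiusOfEntropy]
  linarith

theorem one_sub_overlap_constructedFactors_le (hρ : IsDensity ρ) :
    1 - (ketbra (productKet (constructedFactors ρ)) * ρ).trace.re
      ≤ fUpper (entanglementMeasure ρ) := by
  refine (one_sub_overlap_productKet_le hρ fun n => isPureState_rotatedKet _ _).trans ?_
  refine le_trans (le_of_eq (Finset.sum_congr rfl fun n _ => ?_))
    (sum_one_sub_radiusOfEntropy_le Finset.univ (fun n => renyiTwo (reducedQubit ρ n))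
      (fun n _ => (isDensity_reducedQubit hρ n).renyiTwo_nonneg)
      fun n _ => (isDensity_reducedQubit hρ n).renyiTwo_le_one)
  have hd := isDensity_reducedQubit hρ n
  rw [hd.radiusOfEntropy_renyiTwo, hd.overlap_rotatedKet]
  ring

theorem isPureState_productKet {φ : Fin N → Fin 2 → ℂ} (hφ : ∀ n, IsPureState (φ n)) :
    IsPureState (productKet φ) := by
  simp only [IsPureState, productKet, norm_prod, ← Finset.prod_pow]
  rw [← Fintype.piFinset_univ, ← Finset.prod_univ_sum (fun _ => Finset.univ)
    fun n a => ‖φ n a‖ ^ 2]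
  exact Finset.prod_eq_one fun n _ => hφ n

end Overlap

end NoisyLoading

theorem mainTheorem3 (N : ℕ) (hN : 1 ≤ N) (L : ℕ)
    (U : Fin L → Matrix.unitaryGroup (Register N) ℂ)
    (M K : SuperOp (Register N)) (hM : IsCPTP M) (hK : IsCPTP K)
    (v : Register N → ℂ) (hv : IsPureState v)
    (S : ℝ) (hS : entanglementMeasure (backwardCircuit K U (ketbra v)) = S) :
    (∀ φ : Fin N → Fin 2 → ℂ, (∀ n, IsPureState (φ n)) →
      fLower N S - (L + 1) *
          (diamondNorm (M - LinearMap.id) + diamondNorm (K - LinearMap.id))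
        ≤ infidelity (ketbra v) (forwardCircuit M U (ketbra (productKet φ)))) ∧
    (∃ φ' : Fin N → Fin 2 → ℂ,
      φ' = constructedFactors (backwardCircuit K U (ketbra v)) ∧
      (∀ n, IsPureState (φ' n)) ∧
      infidelity (ketbra v) (forwardCircuit M U (ketbra (productKet φ')))
        ≤ fUpper S + (L + 1) *
          (diamondNorm (M - LinearMap.id) + diamondNorm (K - LinearMap.id))) := by
  have hρ : IsDensity (backwardCircuit K U (ketbra v)) :=
    hK.isDensity_layeredCircuit (isDensity_ketbra hv) L _
  have hcirc (φ : Fin N → Fin 2 → ℂ) (hφ : ∀ n, IsPureState (φ n)) :=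
    abs_le.1 (abs_trace_forwardCircuit_sub_le hM hK U hv (isPureState_productKet hφ))
  refine ⟨fun φ hφ => ?_, _, rfl, fun n => isPureState_rotatedKet _ _, ?_⟩
  · have h1 := fLower_le_one_sub_overlap hN hρ hφ
    rw [hS] at h1
    rw [infidelity]
    linarith [(hcirc φ hφ).2]
  · have h1 := one_sub_overlap_constructedFactors_le hρ
    rw [hS] at h1
    rw [infidelity]
    linarith [(hcirc (constructedFactors (backwardCircuit K U (ketbra v)))
      fun n => isPureState_rotatedKet _ _).1]
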